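/- **Setting and notation.** Let $\mathcal E$ be a finite-dimensional Euclidean space, $\mathcal K\subseteq\mathcal E$ a nonempty closed convex cone with dual cone $\mathcal K^*$, $\mathcal L\subseteq\mathcal E$ a linear subspace and $a\in\mathcal E$, such that $(\mathcal L+a)\cap\mathcal K\ne\emptyset$. Write $B(\eta)=\{x:\|x\|\le\eta\}$, $P_C$ for the projection onto a closed convex set $C$, and $\partial\mathcal K$ for the (topological) boundary of $\mathcal K$. *Error bounds.* Closed convex sets $C_1,C_2$ with $C_1\cap C_2\neq\emptyset$ satisfy a uniform Hölderian error bound with exponent $\gamma\in(0,1]$ if for every bounded $B\subset\mathcal E$ there is $\kappa_B>0$ with $\operatorname{dist}(x,C_1\cap C_2)\le\kappa_B\max\{\operatorname{dist}(x,C_1),\operatorname{dist}(x,C_2)\}^{\gamma}$ for all $x\in B$. A function $\Phi:\mathbb R_+\times\mathbb R_+\to\mathbb R_+$ is a consistent error bound function for $C_1,C_2$ if $\operatorname{dist}(x,C_1\cap C_2)\le\Phi(\max\{\operatorname{dist}(x,C_1),\operatorname{dist}(x,C_2)\},\|x\|)$ for all $x\in\mathcal E$; for every $b\ge0$ the function $\Phi(\cdot,b)$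 is nondecreasing, right-continuous at $0$, and $\Phi(0,b)=0$; and for every $t\ge0$ the function $\Phi(t,\cdot)$ is nondecreasing. *Partial-polyhedral Slater (PPS) condition.* For a closed convex cone $\mathcal C$, the pair $\{\mathcal C,\mathcal L+a\}$ satisfies the PPS condition if $\mathcal C$ is polyhedral, or $(\mathcal L+a)\cap\operatorname{ri}\mathcal C\ne\emptyset$, or $\mathcal C=\mathcal C^1\times\mathcal C^2$ with respect to some direct sum decomposition of $\mathcal E$ into two subspaces, where $\mathcal C^1,\mathcal C^2$ are closed convex cones in the respective summands, $\mathcal C^1$ is polyhedral, and $(\mathcal L+a)\cap(\mathcal C^1\times\operatorname{ri}\mathcal C^2)\neq\emptyset$. **Assumptions.** Let $\alpha\in(0,1)$, $\mathfrak g(t)=|t|^\alpha$, let $z\in\mathcal K^*\cap\mathcal L^\perp\cap\{a\}^\perp$ and $\mathcal F=\mathcal K\cap\{z\}^\perp$, and suppose: 1. $\mathcal F\ne\mathcal K$, $\mathcal F\neq\mathcal K\cap-\mathcal K$, and $\{\mathcal F,\mathcal L+a\}$ satisfies the PPS condition. 2. For every $\eta>0$, $\gamma_{z,\eta}\in(0,\infty]$,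 where $$\gamma_{z,\eta}=\inf_v\Big\{\tfrac{\mathfrak g(\|w-v\|)}{\|w-u\|}\ \Big|\ v\in(\partial\mathcal K\cap B(\eta))\setminus\mathcal F,\ w=P_{\{z\}^\perp}v,\ u=P_{\mathcal F}w,\ w\ne u\Big\}$$ (with $\inf\emptyset=\infty$). 3. There is $S>0$ with $\mathfrak g(\hat\tau s)\le\hat\tau\,\mathfrak g(s)$ for all $s\in[0,S]$, $\hat\tau\ge1$; and there are $\bar v\in\mathcal F\setminus\{0\}$ and a continuous $w:(0,1]\to(\{z\}^\perp\cap\operatorname{span}\mathcal K)\setminus\mathcal F$ with $$\lim_{\epsilon\downarrow0}w_\epsilon=\bar v\quad\text{and}\quad\limsup_{\epsilon\downarrow0}\frac{\mathfrak g(\operatorname{dist}(w_\epsilon,\mathcal K))}{\operatorname{dist}(w_\epsilon,\mathcal F)}<\infty.$$ **Conclusions.** (a) $\mathcal K$ and $\mathcal L+a$ satisfy a uniform Hölderian error bound with exponent $\alpha$. (b) Suppose in addition that $\|z\|=1$, $\mathcal L=\{z\}^\perp$ and $a=0$. Then for every consistent error bound function $\Phi$ for $\mathcal K,\mathcal L$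 and every $\hat\eta>0$ there are constants $\hat\kappa>0$ and $s_0>0$ such that $$s^\alpha\le\hat\kappa\,\Phi(\hat\kappa s,\hat\eta)\qquad\text{for all } s\in[0,s_0].$$ In particular, $\mathcal K$ and $\mathcal L$ do not satisfy a uniform Hölderian error bound with exponent $\hat\alpha$ for any $\hat\alpha$ with $\alpha<\hat\alpha\le1$. -/

import Mathlib

open Filter Topology Metric
open scoped NNReal ENNReal Pointwise RealInnerProductSpace

noncomputable section

namespace ConicErrorBound

variable {E : Type*} [NormedAddCommGroup E] [InnerProductSpace ℝ E]

/-- The hyperplane (or the whole space, if `z = 0`) `{z}^⊥`. -/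
def perp (z : E) : Submodule ℝ E := (ℝ ∙ z)ᗮ

/-- The face `K ∩ {z}^⊥` of the closed convex cone `K` (meant for `z` in the dual cone of `K`).
`ProperCone ℝ E` is Mathlib's type of nonempty closed convex cones; in particular they need be
neither pointed in the sense `K ∩ -K = {0}` nor full-dimensional. -/
def face (K : ProperCone ℝ E) (z : E) : Set E := (K : Set E) ∩ (perp z : Set E)

/-- A face `F` of `K` is nontrivial if it is different from `K` and from `K ∩ -K`. -/
def IsNontrivialFace (K : ProperCone ℝ E) (F : Set E) : Prop :=
  F ≠ (K : Set E) ∩ -(K : Set E) ∧ F ≠ (K : Set E)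

/-- `p` is the metric projection of `x` onto `C`. -/
def IsProjection (C : Set E) (x p : E) : Prop := p ∈ C ∧ ‖x - p‖ = infDist x C

/-- Polyhedral convex cones: intersections of finitely many closed homogeneous half-spaces. -/
def IsPolyhedralCone (C : Set E) : Prop :=
  ∃ T : Finset E, C = {x | ∀ c ∈ T, 0 ≤ ⟪c, x⟫}

/-- The partial-polyhedral Slater condition for a closed convex cone `C` and an affine subspace
`A`. In the last alternative the ambient space is the (internal, not necessarily orthogonal)
direct sum of `V₁` and `V₂`, and `C` is the product of the closed convex cones `C₁ ⊆ V₁`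
and `C₂ ⊆ V₂`. -/
def PPS (C A : Set E) : Prop :=
  IsPolyhedralCone C ∨
  (A ∩ intrinsicInterior ℝ C).Nonempty ∨
  ∃ (V₁ V₂ : Submodule ℝ E) (C₁ C₂ : ProperCone ℝ E),
    IsCompl V₁ V₂ ∧ (C₁ : Set E) ⊆ V₁ ∧ (C₂ : Set E) ⊆ V₂ ∧
    C = (C₁ : Set E) + (C₂ : Set E) ∧ IsPolyhedralCone (C₁ : Set E) ∧
    (A ∩ ((C₁ : Set E) + intrinsicInterior ℝ (C₂ : Set E))).Nonempty

/-- The constant `γ_{z,η} ∈ [0,∞]`: the infimum of `g ‖w - v‖ / ‖w - u‖` over all `v` of norm at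
most `η` in the boundary of `K` but not in `F = K ∩ {z}^⊥`, where `w` is the projection of `v`
onto `{z}^⊥` and `u ≠ w` is the projection of `w` onto `F`. It is `∞` if there is no such `v`. -/
def gammaConst (K : ProperCone ℝ E) (z : E) (g : ℝ → ℝ) (η : ℝ) : ℝ≥0∞ :=
  sInf {r | ∃ v w u : E, v ∈ (frontier (K : Set E) ∩ closedBall 0 η) \ face K z ∧
    IsProjection (perp z : Set E) v w ∧ IsProjection (face K z) w u ∧ w ≠ u ∧
    r = ENNReal.ofReal (g ‖w - v‖ / ‖w - u‖)}

/-- Partial sub-homogeneity of `g : ℝ₊ → ℝ₊`. -/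
def PartiallySubhomogeneous (g : ℝ → ℝ) : Prop :=
  ∃ S > 0, ∀ s ∈ Set.Icc (0 : ℝ) S, ∀ τ : ℝ, 1 ≤ τ → g (τ * s) ≤ τ * g s

/-- The asymptotic optimality criterion of `g` for `K` and `z`. The upper limit is taken in the
extended reals. -/
def AsymptoticallyOptimal (K : ProperCone ℝ E) (z : E) (g : ℝ → ℝ) : Prop :=
  ∃ v ∈ face K z \ {0}, ∃ w : ℝ → E,
    ContinuousOn w (Set.Ioc 0 1) ∧
    (∀ ε ∈ Set.Ioc (0 : ℝ) 1,
      w ε ∈ ((perp z : Set E) ∩ (Submodule.span ℝ (K : Set E) : Set E)) \ face K z) ∧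
    Tendsto w (𝓝[>] 0) (𝓝 v) ∧
    limsup (fun ε : ℝ =>
      ((g (infDist (w ε) (K : Set E)) / infDist (w ε) (face K z) : ℝ) : EReal)) (𝓝[>] 0) < ⊤

/-- Uniform Hölderian error bound with exponent `γ` for two (intersecting closed convex) sets. -/
def UniformHolderErrorBound (C₁ C₂ : Set E) (γ : ℝ) : Prop :=
  ∀ B : Set E, Bornology.IsBounded B → ∃ κ > 0, ∀ x ∈ B,
    infDist x (C₁ ∩ C₂) ≤ κ * (max (infDist x C₁) (infDist x C₂)) ^ γ

/-- `Φ : ℝ₊ × ℝ₊ → ℝ₊` (in curried form) is a consistent error bound function for two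
(intersecting closed convex) sets. -/
structure IsConsistentErrorBound (C₁ C₂ : Set E) (Φ : ℝ≥0 → ℝ≥0 → ℝ≥0) : Prop where
  infDist_le : ∀ x : E,
    infDist x (C₁ ∩ C₂) ≤ Φ (max (infNndist x C₁) (infNndist x C₂)) ‖x‖₊
  mono_left : ∀ b : ℝ≥0, Monotone fun a => Φ a b
  rightContinuous_zero : ∀ b : ℝ≥0, Tendsto (fun a => Φ a b) (𝓝[>] 0) (𝓝 (Φ 0 b))
  map_zero : ∀ b : ℝ≥0, Φ 0 b = 0
  mono_right : ∀ a : ℝ≥0, Monotone (Φ a)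

end ConicErrorBound

end

/-! Write F for the face cut out by z and A for the affine space. Since A lies in the hyperplane of
z, K ∩ A = F ∩ A, so the upper bound is the composition of two estimates on a bounded set. The PPS
condition makes F and A boundedly linearly regular (`PPS.exists_infDist_inter_le`): relax the
non-polyhedral factor of F to its span, apply Hoffman's lemma to the resulting polyhedra, then move
towards the Slater point by an amount proportional to the error. Positivity of `gammaConst` bounds
the distance to F by the power α of the distances to K and to the hyperplane
(`exists_infDist_face_le`), and that power dominates linear terms on bounded sets.

For optimality, K meets the hyperplane exactly in F. Along the given curve in the hyperplane the
only nonzero residual is the distance to K, whose power α is at most a multiple of the distance to F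
(`AsymptoticallyOptimal.exists_curve`). Any error bound tested on this curve, rescaled by conicity
where its norm matters, inherits the rate α. -/

namespace ConicErrorBound

/-! ### Polyhedra and Hoffman's error bound. -/

section Hoffman

variable {E : Type*} [NormedAddCommGroup E] [InnerProductSpace ℝ E]

/-- Vectors in the polar of `{e | ∀ i ∈ I, ⟪c i, e⟫ ≤ 0}` are controlled by the positive parts of
their inner products with the `c i`. -/
lemma exists_norm_le_sum_pos_of_mem_polar [FiniteDimensional ℝ E] {ι : Type*} (I : Finset ι)
    (c : ι → E) :
    ∃ κ : ℝ, 0 ≤ κ ∧ ∀ d : E, (∀ e : E, (∀ i ∈ I, ⟪c i, e⟫ ≤ 0) → ⟪d, e⟫ ≤ 0) →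
      ‖d‖ ≤ κ * ∑ i ∈ I, max ⟪c i, d⟫ 0 := by
  set N : Set E := {d | ∀ e : E, (∀ i ∈ I, ⟪c i, e⟫ ≤ 0) → ⟪d, e⟫ ≤ 0} with hN
  have hNc : IsClosed N := by
    simp only [hN, Set.ofPred_forall]
    refine isClosed_iInter fun e => isClosed_iInter fun _ => ?_
    exact isClosed_le (by fun_prop) (by fun_prop)
  have hcont : Continuous fun d : E => ∑ i ∈ I, max ⟪c i, d⟫ 0 := by fun_prop
  have hcomp : IsCompact (N ∩ sphere (0 : E) 1) := (isCompact_sphere 0 1).inter_left hNc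
  -- If every positive part vanished, `d` could be tested against itself in the polar condition,
  -- forcing `‖d‖ ^ 2 ≤ 0`.
  have hpos : ∀ d ∈ N ∩ sphere (0 : E) 1, 0 < ∑ i ∈ I, max ⟪c i, d⟫ 0 := by
    rintro d ⟨hd, hd1⟩
    refine lt_of_le_of_ne (Finset.sum_nonneg fun i _ => le_max_right _ _) fun h => ?_
    have h0 := (Finset.sum_eq_zero_iff_of_nonneg fun i _ => le_max_right _ _).1 h.symm
    have := hd d fun i hi => (le_max_left _ _).trans (h0 i hi).le
    rw [real_inner_self_eq_norm_sq] at this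
    have h1 : ‖d‖ = 1 := by simpa using hd1
    rw [h1] at this
    norm_num at this
  obtain ⟨μ, hμ, hμle⟩ : ∃ μ : ℝ, 0 < μ ∧
      ∀ d ∈ N ∩ sphere (0 : E) 1, μ ≤ ∑ i ∈ I, max ⟪c i, d⟫ 0 := by
    rcases (N ∩ sphere (0 : E) 1).eq_empty_or_nonempty with h | h
    · exact ⟨1, one_pos, by simp [h]⟩
    · obtain ⟨d₀, hd₀, hmin⟩ := hcomp.exists_isMinOn h hcont.continuousOn
      exact ⟨_, hpos d₀ hd₀, fun d hd => hmin hd⟩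
  refine ⟨μ⁻¹, by positivity, fun d hd => ?_⟩
  rcases eq_or_ne d 0 with rfl | hd0
  · simp
  have hn : 0 < ‖d‖ := norm_pos_iff.2 hd0
  have hmem : ‖d‖⁻¹ • d ∈ N ∩ sphere (0 : E) 1 := by
    refine ⟨fun e he => ?_, by simp [norm_smul, hn.ne']⟩
    rw [real_inner_smul_left]
    exact mul_nonpos_of_nonneg_of_nonpos (by positivity) (hd e he)
  have h := hμle _ hmem
  have hs : ∑ i ∈ I, max ⟪c i, ‖d‖⁻¹ • d⟫ 0 = ‖d‖⁻¹ * ∑ i ∈ I, max ⟪c i, d⟫ 0 := by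
    rw [Finset.mul_sum]
    refine Finset.sum_congr rfl fun i _ => ?_
    rw [real_inner_smul_right, mul_max_of_nonneg _ _ (by positivity : 0 ≤ ‖d‖⁻¹), mul_zero]
  rw [hs] at h
  rw [inv_mul_eq_div, le_div_iff₀ hμ]
  rw [inv_mul_eq_div, le_div_iff₀ hn] at h
  linarith

/-- Polyhedra: intersections of finitely many closed half-spaces. -/
def IsPolyhedron (P : Set E) : Prop :=
  ∃ T : Finset (E × ℝ), P = {x | ∀ p ∈ T, ⟪p.1, x⟫ ≤ p.2}

lemma IsPolyhedron.inter {P Q : Set E} (hP : IsPolyhedron P) (hQ : IsPolyhedron Q) :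
    IsPolyhedron (P ∩ Q) := by
  classical
  obtain ⟨T, rfl⟩ := hP
  obtain ⟨U, rfl⟩ := hQ
  refine ⟨T ∪ U, ?_⟩
  ext x
  simp only [Set.mem_inter_iff, Set.mem_ofPred_eq, Finset.mem_union, or_imp, forall_and]

lemma IsPolyhedralCone.isPolyhedron {P : Set E} (hP : IsPolyhedralCone P) : IsPolyhedron P := by
  classical
  obtain ⟨T, rfl⟩ := hP
  refine ⟨T.image fun c => (-c, 0), ?_⟩
  ext x
  simp [inner_neg_left]

lemma IsPolyhedron.preimage [FiniteDimensional ℝ E] {P : Set E} (hP : IsPolyhedron P)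
    (f : E →ₗ[ℝ] E) : IsPolyhedron (f ⁻¹' P) := by
  classical
  obtain ⟨T, rfl⟩ := hP
  refine ⟨T.image fun p => (LinearMap.adjoint f p.1, p.2), ?_⟩
  ext x
  simp only [Set.mem_preimage, Set.mem_ofPred_eq, Finset.forall_mem_image,
    LinearMap.adjoint_inner_left]

lemma isPolyhedron_affineSubspace [FiniteDimensional ℝ E] (L : Submodule ℝ E) (a : E) :
    IsPolyhedron (AffineSubspace.mk' a L : Set E) := by
  classical
  obtain ⟨T, hT⟩ := (IsNoetherian.noetherian Lᗮ : Lᗮ.FG)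
  refine ⟨T.image (fun c => (c, ⟪c, a⟫)) ∪ T.image (fun c => (-c, -⟪c, a⟫)), ?_⟩
  ext x
  have h1 : x ∈ (AffineSubspace.mk' a L : Set E) ↔ ∀ c ∈ T, ⟪c, x - a⟫ = 0 := by
    rw [SetLike.mem_coe, AffineSubspace.mem_mk', vsub_eq_sub, ← Submodule.orthogonal_orthogonal L,
      Submodule.mem_orthogonal, ← hT]
    refine ⟨fun h c hc => h c (Submodule.subset_span hc), fun h u hu => ?_⟩
    induction hu using Submodule.span_induction with
    | mem x hx => exact h x hx
    | zero => simp
    | add x y _ _ hx hy => simp [inner_add_left, hx, hy]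
    | smul r x _ hx => simp [real_inner_smul_left, hx]
  rw [h1]
  simp only [Set.mem_ofPred_eq, Finset.mem_union, or_imp, forall_and, Finset.forall_mem_image,
    inner_neg_left, inner_sub_right]
  refine ⟨fun h => ⟨fun c hc => by linarith [h c hc], fun c hc => by linarith [h c hc]⟩,
    fun h c hc => by linarith [h.1 hc, h.2 hc]⟩

lemma IsPolyhedron.isClosed {P : Set E} (hP : IsPolyhedron P) : IsClosed P := by
  obtain ⟨T, rfl⟩ := hP
  simp only [Set.ofPred_forall]
  exact isClosed_iInter fun p => isClosed_iInter fun _ => isClosed_le (by fun_prop) (by fun_prop)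

lemma IsPolyhedron.convex {P : Set E} (hP : IsPolyhedron P) : Convex ℝ P := by
  obtain ⟨T, rfl⟩ := hP
  simp only [Set.ofPred_forall]
  exact convex_iInter fun p => convex_iInter fun _ =>
    convex_halfSpace_le ((innerSL ℝ p.1).toLinearMap.isLinear) _

/-- **Hoffman's lemma**. -/
lemma hoffman [FiniteDimensional ℝ E] (T : Finset (E × ℝ))
    (hne : {x : E | ∀ p ∈ T, ⟪p.1, x⟫ ≤ p.2}.Nonempty) :
    ∃ κ : ℝ, 0 ≤ κ ∧ ∀ x : E, infDist x {x : E | ∀ p ∈ T, ⟪p.1, x⟫ ≤ p.2} ≤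
      κ * ∑ p ∈ T, max (⟪p.1, x⟫ - p.2) 0 := by
  classical
  set P : Set E := {x : E | ∀ p ∈ T, ⟪p.1, x⟫ ≤ p.2} with hP
  have hPoly : IsPolyhedron P := ⟨T, rfl⟩
  choose κ hκ0 hκ using fun I : Finset (E × ℝ) => exists_norm_le_sum_pos_of_mem_polar I Prod.fst
  -- The active set depends on `x`, but there are only finitely many candidates; summing over all of
  -- them gives a uniform constant.
  refine ⟨∑ I ∈ T.powerset, κ I, Finset.sum_nonneg fun I _ => hκ0 I, fun x => ?_⟩
  obtain ⟨y, hy, hxy⟩ := exists_norm_eq_iInf_of_complete_convex hne hPoly.isClosed.isComplete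
    hPoly.convex x
  have hvar := (norm_eq_iInf_iff_real_inner_le_zero hPoly.convex hy).1 hxy
  set I := T.filter fun p => ⟪p.1, y⟫ = p.2 with hI
  -- The residual is normal to the polyhedron at `y`: inactive constraints stay satisfied for small
  -- `t`, so a direction admissible for the active ones is feasible.
  have hpolar : ∀ e : E, (∀ p ∈ I, ⟪p.1, e⟫ ≤ 0) → ⟪x - y, e⟫ ≤ 0 := by
    intro e he
    have hev : ∀ᶠ t in 𝓝[>] (0 : ℝ), ∀ p ∈ T, ⟪p.1, y + t • e⟫ ≤ p.2 := by
      rw [Filter.eventually_all_finset]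
      intro p hp
      by_cases hpa : ⟪p.1, y⟫ = p.2
      · filter_upwards [self_mem_nhdsWithin] with t ht
        have := he p (Finset.mem_filter.2 ⟨hp, hpa⟩)
        rw [inner_add_right, real_inner_smul_right, hpa]
        have ht' : (0 : ℝ) < t := ht
        nlinarith
      · have hlt : ⟪p.1, y + (0 : ℝ) • e⟫ < p.2 := by
          simpa using lt_of_le_of_ne (hy p hp) hpa
        have hc : Continuous fun t : ℝ => ⟪p.1, y + t • e⟫ := by fun_prop
        exact ((hc.continuousAt.eventually_lt continuousAt_const hlt).filter_mono
          nhdsWithin_le_nhds).mono fun t => le_of_lt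
    obtain ⟨t, ht, ht0⟩ := (hev.and self_mem_nhdsWithin).exists
    have h := hvar _ ht
    rw [add_sub_cancel_left, real_inner_smul_right] at h
    exact nonpos_of_mul_nonpos_right h ht0
  calc infDist x P ≤ dist x y := infDist_le_dist_of_mem hy
    _ = ‖x - y‖ := dist_eq_norm _ _
    _ ≤ κ I * ∑ p ∈ I, max ⟪p.1, x - y⟫ 0 := hκ I _ hpolar
    _ = κ I * ∑ p ∈ I, max (⟪p.1, x⟫ - p.2) 0 := by
        congr 1
        refine Finset.sum_congr rfl fun p hp => ?_
        rw [inner_sub_right, (Finset.mem_filter.1 hp).2]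
    _ ≤ (∑ I ∈ T.powerset, κ I) * ∑ p ∈ T, max (⟪p.1, x⟫ - p.2) 0 := by
        gcongr
        · exact Finset.sum_nonneg fun I _ => hκ0 I
        · exact Finset.single_le_sum (fun I _ => hκ0 I)
            (Finset.mem_powerset.2 (Finset.filter_subset _ _))
        · exact Finset.filter_subset _ _

/-- Converts the constraint violations in Hoffman's bound into distances to each of the two
polyhedra. Near-minimizers suffice, so `P` need not be closed. -/
lemma max_inner_sub_le_mul_infDist {P : Set E} (hP : P.Nonempty) {c : E} {b : ℝ}
    (h : ∀ y ∈ P, ⟪c, y⟫ ≤ b) (x : E) : max (⟪c, x⟫ - b) 0 ≤ ‖c‖ * infDist x P := by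
  refine max_le ?_ (mul_nonneg (norm_nonneg _) infDist_nonneg)
  refine le_of_forall_pos_le_add fun ε hε => ?_
  obtain ⟨y, hy, hxy⟩ := (infDist_lt_iff hP).1
    (lt_add_of_pos_right (infDist x P) (by positivity : 0 < ε / (‖c‖ + 1)))
  have h1 : ⟪c, x - y⟫ ≤ ‖c‖ * ‖x - y‖ := real_inner_le_norm _ _
  rw [inner_sub_right] at h1
  rw [dist_eq_norm] at hxy
  have h2 : ‖c‖ * ‖x - y‖ ≤ ‖c‖ * (infDist x P + ε / (‖c‖ + 1)) := by gcongr
  have h3 : ‖c‖ * (ε / (‖c‖ + 1)) ≤ ε := by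
    rw [mul_div_assoc', div_le_iff₀ (by positivity)]
    nlinarith [norm_nonneg c]
  linarith [h y hy]

/-- Two intersecting polyhedra satisfy a global Lipschitz error bound. -/
lemma IsPolyhedron.exists_infDist_inter_le [FiniteDimensional ℝ E] {P Q : Set E}
    (hP : IsPolyhedron P) (hQ : IsPolyhedron Q) (hne : (P ∩ Q).Nonempty) :
    ∃ κ : ℝ, 0 ≤ κ ∧ ∀ x : E, infDist x (P ∩ Q) ≤ κ * max (infDist x P) (infDist x Q) := by
  classical
  obtain ⟨T, rfl⟩ := hP
  obtain ⟨U, rfl⟩ := hQ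
  have hTU : {x : E | ∀ p ∈ T, ⟪p.1, x⟫ ≤ p.2} ∩ {x : E | ∀ p ∈ U, ⟪p.1, x⟫ ≤ p.2} =
      {x : E | ∀ p ∈ T ∪ U, ⟪p.1, x⟫ ≤ p.2} := by
    ext x
    simp only [Set.mem_inter_iff, Set.mem_ofPred_eq, Finset.mem_union, or_imp, forall_and]
  obtain ⟨κ, hκ, h⟩ := hoffman (T ∪ U) (hTU ▸ hne)
  refine ⟨κ * ∑ p ∈ T ∪ U, ‖p.1‖, mul_nonneg hκ (Finset.sum_nonneg fun _ _ => norm_nonneg _),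
    fun x => ?_⟩
  rw [hTU, mul_assoc, Finset.sum_mul]
  refine (h x).trans ?_
  gcongr with p hp
  rcases Finset.mem_union.1 hp with hp | hp
  · exact (max_inner_sub_le_mul_infDist hne.left (fun y hy => hy p hp) x).trans
      (by gcongr; exact le_max_left _ _)
  · exact (max_inner_sub_le_mul_infDist hne.right (fun y hy => hy p hp) x).trans
      (by gcongr; exact le_max_right _ _)

end Hoffman

/-! ### Bounded linear regularity under the PPS condition. -/

section Slater

variable {E : Type*} [NormedAddCommGroup E] [InnerProductSpace ℝ E]

/-- A relative interior point of a set containing the origin is the centre of a ball of its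
linear span that is contained in the set. -/
lemma exists_pos_forall_add_mem_of_mem_intrinsicInterior {C : Set E} (h0 : (0 : E) ∈ C) {c : E}
    (hc : c ∈ intrinsicInterior ℝ C) :
    ∃ r > 0, ∀ e ∈ Submodule.span ℝ C, ‖e‖ < r → c + e ∈ C := by
  obtain ⟨y, hy, rfl⟩ := mem_intrinsicInterior.1 hc
  obtain ⟨r, hr, hball⟩ := Metric.isOpen_iff.1 isOpen_interior y hy
  refine ⟨r, hr, fun e he her => ?_⟩
  have hdir : e ∈ (affineSpan ℝ C).direction := by
    rw [direction_affineSpan, vectorSpan_eq_span_vsub_set_right ℝ h0]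
    simpa using he
  have hmem : (y : E) + e ∈ affineSpan ℝ C := by
    rw [add_comm]
    exact AffineSubspace.vadd_mem_of_mem_direction hdir y.2
  have : (⟨(y : E) + e, hmem⟩ : affineSpan ℝ C) ∈ ball y r := by
    rw [mem_ball, Subtype.dist_eq]
    simpa using her
  exact interior_subset (s := ((↑) ⁻¹' C : Set (affineSpan ℝ C))) (hball this)

/-- Bounded linear regularity of a closed set `C₁ + C₂`, with `C₁` a polyhedron, and an affine
subspace through `C₁ + ri C₂`. -/
lemma exists_infDist_inter_le_of_isCompl [FiniteDimensional ℝ E] {V₁ V₂ : Submodule ℝ E}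
    (hV : IsCompl V₁ V₂) {C₁ C₂ : Set E} (h₁ : C₁ ⊆ V₁) (h₂ : C₂ ⊆ V₂) (hC₁ : IsPolyhedron C₁)
    (hC₂ : Convex ℝ C₂) (h0 : (0 : E) ∈ C₂) (hcl : IsClosed (C₁ + C₂)) (L : Submodule ℝ E)
    (a : E) (hne : ((AffineSubspace.mk' a L : Set E) ∩ (C₁ + intrinsicInterior ℝ C₂)).Nonempty)
    (R : ℝ) :
    ∃ κ : ℝ, 0 ≤ κ ∧ ∀ x : E, ‖x‖ ≤ R →
      infDist x ((C₁ + C₂) ∩ (AffineSubspace.mk' a L : Set E)) ≤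
        κ * max (infDist x (C₁ + C₂)) (infDist x (AffineSubspace.mk' a L : Set E)) := by
  set A : Set E := (AffineSubspace.mk' a L : Set E) with hA
  have hAc : Convex ℝ A := (AffineSubspace.mk' a L).convex
  obtain ⟨q, hqA, c₁, hc₁, c₂, hc₂, hq⟩ := hne
  obtain ⟨r, hr, hball⟩ := exists_pos_forall_add_mem_of_mem_intrinsicInterior h0 hc₂
  have hc₂' : c₂ ∈ C₂ := intrinsicInterior_subset hc₂
  set π₁ : E →ₗ[ℝ] E := V₁.projection V₂ hV
  set π₂ : E →ₗ[ℝ] E := V₂.projection V₁ hV.symm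
  have hsum : ∀ x, π₁ x + π₂ x = x := Submodule.projection_add_projection_eq_self hV
  have hπ₁ : ∀ u ∈ V₁, ∀ v ∈ V₂, π₁ (u + v) = u := fun u hu v hv => by
    rw [map_add, Submodule.projection_apply_of_mem_left hV hu,
      (Submodule.projection_apply_eq_zero_iff hV).2 hv, add_zero]
  have hπ₂ : ∀ u ∈ V₁, ∀ v ∈ V₂, π₂ (u + v) = v := fun u hu v hv => by
    rw [map_add, Submodule.projection_apply_of_mem_left hV.symm hv,
      (Submodule.projection_apply_eq_zero_iff hV.symm).2 hu, zero_add]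
  set S := Submodule.span ℝ C₂
  have hSpoly : IsPolyhedron (S : Set E) := by
    have := isPolyhedron_affineSubspace S 0
    convert this using 1
    ext x
    simp [AffineSubspace.mem_mk']
  -- Polyhedral relaxation of `C₁ + C₂`, with `C₂` replaced by its span; Hoffman's bound applies to
  -- `D ∩ A`.
  set D : Set E := π₁ ⁻¹' C₁ ∩ π₂ ⁻¹' S
  have hCD : C₁ + C₂ ⊆ D := by
    rintro _ ⟨u, hu, v, hv, rfl⟩
    refine ⟨?_, ?_⟩
    · simpa [hπ₁ u (h₁ hu) v (h₂ hv)] using hu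
    · simpa [hπ₂ u (h₁ hu) v (h₂ hv)] using Submodule.subset_span hv
  have hqC : q ∈ C₁ + C₂ := ⟨c₁, hc₁, c₂, hc₂', hq⟩
  have hqD : q ∈ D := hCD hqC
  have hqπ₁ : π₁ q = c₁ := by rw [← hq]; exact hπ₁ _ (h₁ hc₁) _ (h₂ hc₂')
  have hqπ₂ : π₂ q = c₂ := by rw [← hq]; exact hπ₂ _ (h₁ hc₁) _ (h₂ hc₂')
  have hDpoly : IsPolyhedron D := (hC₁.preimage π₁).inter (hSpoly.preimage π₂)
  have hApoly : IsPolyhedron A := isPolyhedron_affineSubspace L a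
  obtain ⟨κ, hκ, hDA⟩ := hDpoly.exists_infDist_inter_le hApoly ⟨q, hqD, hqA⟩
  obtain ⟨M, hM, hMle⟩ : ∃ M : ℝ, 0 < M ∧ ∀ x, ‖π₂ x‖ ≤ M * ‖x‖ :=
    (LinearMap.toContinuousLinearMap π₂).isBoundedLinearMap.bound
  have hR : ∀ x : E, ‖x‖ ≤ R → dist x q ≤ R + ‖q‖ := fun x hx =>
    (dist_eq_norm x q ▸ norm_sub_le x q).trans (by linarith)
  set W : ℝ := (κ + 1) * (R + ‖q‖)
  -- The second summand is `θ / r * |W|` divided by `δ`, for the `θ` below. The absolute value keeps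
  -- it nonnegative even when `R` is negative.
  refine ⟨κ + 2 * M * (κ + 1) * |W| / r, by positivity, fun x hx => ?_⟩
  set δ := max (infDist x (C₁ + C₂)) (infDist x A) with hδ
  have hδ0 : 0 ≤ δ := infDist_nonneg.trans (le_max_left _ _)
  have hδR : δ ≤ R + ‖q‖ :=
    max_le ((infDist_le_dist_of_mem hqC).trans (hR x hx))
      ((infDist_le_dist_of_mem hqA).trans (hR x hx))
  obtain ⟨y, ⟨hyD, hyA⟩, hxy⟩ := (hDpoly.inter hApoly).isClosed.exists_infDist_eq_dist
    ⟨q, hqD, hqA⟩ x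
  have hxy' : dist x y ≤ κ * δ := hxy ▸ (hDA x).trans
    (by gcongr; exact max_le_max (infDist_le_infDist_of_subset hCD ⟨q, hqC⟩) le_rfl)
  obtain ⟨c, hc, hxc⟩ := hcl.exists_infDist_eq_dist ⟨q, hqC⟩ x
  have hxc' : dist x c ≤ δ := hxc ▸ le_max_left _ _
  have hyc : ‖y - c‖ ≤ (κ + 1) * δ := by
    rw [← dist_eq_norm]
    have := dist_triangle_left y c x
    linarith
  have hyq : ‖y - q‖ ≤ W := by
    rw [← dist_eq_norm]
    have h1 := dist_triangle_left y q x
    have h2 := hR x hx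
    have h3 : κ * δ ≤ κ * (R + ‖q‖) := by gcongr
    simp only [W]
    linarith
  obtain ⟨u, hu, p, hp, rfl⟩ := hc
  -- `y` lies in `D ∩ A` and can miss `C₁ + C₂` only in its second component; `e`, of size O(δ),
  -- measures this defect.
  set e := π₂ y - p with he
  have hep : e = π₂ (y - (u + p)) := by rw [map_sub, hπ₂ u (h₁ hu) p (h₂ hp)]
  have heS : e ∈ S := S.sub_mem hyD.2 (Submodule.subset_span hp)
  -- Twice the bound on `‖e‖`: the slack yields the strict inequality required by the open ball
  -- around `c₂`.
  set θ := 2 * (M * ((κ + 1) * δ)) with hθ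
  have hθ0 : 0 ≤ θ := by positivity
  have heθ : ‖e‖ ≤ θ / 2 := by
    rw [hep, hθ, mul_div_cancel_left₀ _ two_ne_zero]
    exact (hMle _).trans (by gcongr)
  rcases hδ0.eq_or_lt with hδz | hδpos
  · have hx0 : infDist x (C₁ + C₂) = 0 ∧ infDist x A = 0 :=
      ⟨le_antisymm (hδz ▸ le_max_left _ _) infDist_nonneg,
        le_antisymm (hδz ▸ le_max_right _ _) infDist_nonneg⟩
    have hxC : x ∈ (C₁ + C₂) ∩ A :=
      ⟨(hcl.mem_iff_infDist_zero ⟨q, hqC⟩).2 hx0.1,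
        (hApoly.isClosed.mem_iff_infDist_zero ⟨q, hqA⟩).2 hx0.2⟩
    rw [infDist_zero_of_mem hxC]
    positivity
  have hθpos : 0 < θ := by positivity
  -- the convex combination `(1 - t) y + t q` lies in the intersection
  set t := θ / (r + θ) with ht
  have ht0 : 0 < t := by positivity
  have ht1 : 1 - t = r / (r + θ) := by rw [ht]; field_simp; ring
  have ht1' : 0 < 1 - t := by rw [ht1]; positivity
  have htr : t ≤ θ / r := by rw [ht]; gcongr; linarith
  -- Rewrite the point as `(1 - t) p + t (c₂ + ((1 - t) / t) e)`. Since `(1 - t) / t = r / θ`, the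
  -- defect fits in the relative ball around `c₂`.
  have hzC₂ : (1 - t) • π₂ y + t • c₂ ∈ C₂ := by
    have hb : c₂ + ((1 - t) / t) • e ∈ C₂ := by
      refine hball _ (S.smul_mem _ heS) ?_
      have htt : (1 - t) / t = r / θ := by rw [ht1, ht]; field_simp
      rw [htt, norm_smul, Real.norm_of_nonneg (by positivity), div_mul_eq_mul_div,
        div_lt_iff₀ hθpos]
      gcongr
      linarith
    have := hC₂ hp hb ht1'.le ht0.le (by ring)
    convert this using 1
    rw [smul_add, smul_smul, mul_div_cancel₀ _ ht0.ne', he, smul_sub]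
    abel
  have hz : (1 - t) • y + t • q ∈ (C₁ + C₂) ∩ A := by
    refine ⟨⟨(1 - t) • π₁ y + t • c₁, hC₁.convex hyD.1 hc₁ ht1'.le ht0.le (by ring), _, hzC₂, ?_⟩,
      hAc hyA hqA ht1'.le ht0.le (by ring)⟩
    change (1 - t) • π₁ y + t • c₁ + ((1 - t) • π₂ y + t • c₂) = _
    conv_rhs => rw [← hsum y, ← hsum q, hqπ₁, hqπ₂]
    module
  calc infDist x ((C₁ + C₂) ∩ A) ≤ dist x ((1 - t) • y + t • q) := infDist_le_dist_of_mem hz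
    _ ≤ dist x y + dist y ((1 - t) • y + t • q) := dist_triangle _ _ _
    _ = dist x y + t * ‖y - q‖ := by
        rw [dist_eq_norm y, show y - ((1 - t) • y + t • q) = t • (y - q) by module, norm_smul,
          Real.norm_of_nonneg ht0.le]
    _ ≤ κ * δ + θ / r * |W| := by
        gcongr
        exact hyq.trans (le_abs_self _)
    _ = (κ + 2 * M * (κ + 1) * |W| / r) * δ := by rw [hθ]; ring

/-- Under the partial-polyhedral Slater condition a closed convex set containing the origin and an
affine subspace are boundedly linearly regular. -/
lemma PPS.exists_infDist_inter_le [FiniteDimensional ℝ E] {C : Set E} (hcl : IsClosed C)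
    (hconv : Convex ℝ C) (h0 : (0 : E) ∈ C) (L : Submodule ℝ E) (a : E)
    (hne : (C ∩ (AffineSubspace.mk' a L : Set E)).Nonempty)
    (hPPS : PPS C (AffineSubspace.mk' a L : Set E)) (R : ℝ) :
    ∃ κ : ℝ, 0 ≤ κ ∧ ∀ x : E, ‖x‖ ≤ R →
      infDist x (C ∩ (AffineSubspace.mk' a L : Set E)) ≤
        κ * max (infDist x C) (infDist x (AffineSubspace.mk' a L : Set E)) := by
  rcases hPPS with h | ⟨q, hqA, hqC⟩ | ⟨V₁, V₂, C₁, C₂, hV, h₁, h₂, rfl, hpoly, hA⟩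
  · obtain ⟨κ, hκ, h⟩ := h.isPolyhedron.exists_infDist_inter_le
      (isPolyhedron_affineSubspace L a) hne
    exact ⟨κ, hκ, fun x _ => h x⟩
  -- The plain Slater case is the product case for the decomposition `⊥ ⊕ ⊤` with `C₁ = {0}`.
  · have hpoly : IsPolyhedron ({0} : Set E) := by
      have := isPolyhedron_affineSubspace (⊥ : Submodule ℝ E) 0
      convert this using 1
      ext x
      simp [AffineSubspace.mem_mk']
    have := exists_infDist_inter_le_of_isCompl (isCompl_bot_top (α := Submodule ℝ E))
      (C₁ := {0}) (C₂ := C) (by simp) (by simp) hpoly hconv h0 (by simpa using hcl) L a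
      ⟨q, hqA, by simpa using hqC⟩ R
    simpa using this
  · exact exists_infDist_inter_le_of_isCompl hV h₁ h₂ hpoly.isPolyhedron C₂.convex C₂.zero_mem
      hcl L a hA R

end Slater

/-! ### Distance to the exposed face. -/

section Face

variable {E : Type*} [NormedAddCommGroup E] [InnerProductSpace ℝ E]

lemma mem_perp {z x : E} : x ∈ perp z ↔ ⟪z, x⟫ = 0 :=
  Submodule.mem_orthogonal_singleton_iff_inner_right

lemma isClosed_perp (z : E) : IsClosed (perp z : Set E) :=
  Submodule.isClosed_orthogonal _

lemma isClosed_face (K : ProperCone ℝ E) (z : E) : IsClosed (face K z) :=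
  K.isClosed.inter (isClosed_perp z)

lemma convex_face (K : ProperCone ℝ E) (z : E) : Convex ℝ (face K z) :=
  K.convex.inter (perp z).convex

lemma zero_mem_face (K : ProperCone ℝ E) (z : E) : (0 : E) ∈ face K z :=
  ⟨K.zero_mem, (perp z).zero_mem⟩

lemma smul_face (K : ProperCone ℝ E) (z : E) {t : ℝ} (ht : 0 < t) : t • face K z = face K z := by
  ext x
  rw [Set.mem_smul_set_iff_inv_smul_mem₀ ht.ne']
  have h : ∀ {s : ℝ} {y : E}, 0 < s → y ∈ face K z → s • y ∈ face K z := fun hs hy =>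
    ⟨K.smul_mem hy.1 hs.le, (perp z).smul_mem _ hy.2⟩
  refine ⟨fun hx => ?_, h (inv_pos.2 ht)⟩
  simpa [smul_smul, ht.ne'] using h ht hx

lemma smul_properCone (K : ProperCone ℝ E) {t : ℝ} (ht : 0 < t) :
    t • (K : Set E) = (K : Set E) := by
  have hf : face K 0 = (K : Set E) := by
    ext x
    simp [face, perp]
  rw [← hf, smul_face K 0 ht]

lemma infDist_smul_of_smul_eq {C : Set E} {t : ℝ} (ht : 0 < t) (hC : t • C = C) (x : E) :
    infDist (t • x) C = t * infDist x C := by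
  conv_lhs => rw [← hC]
  rw [infDist_smul₀ ht.ne', Real.norm_of_nonneg ht.le]

/-- Absorbs linear error terms into Hölderian ones on bounded sets. -/
lemma le_rpow_mul_rpow {s b α : ℝ} (hs : 0 ≤ s) (hsb : s ≤ b) (hα : α ≤ 1) :
    s ≤ b ^ (1 - α) * s ^ α := by
  calc s = s ^ (1 - α) * s ^ α := by
        rw [← Real.rpow_add' hs (by norm_num), sub_add_cancel, Real.rpow_one]
    _ ≤ b ^ (1 - α) * s ^ α := by
        gcongr

/-- On bounded sets, a positive constant `gammaConst` yields a Hölderian bound for the distance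
to the face in terms of the distances to the cone and to the hyperplane. -/
lemma exists_infDist_face_le [FiniteDimensional ℝ E] (K : ProperCone ℝ E) (z : E) {α : ℝ}
    (hα : α ∈ Set.Ioo (0 : ℝ) 1)
    (hγ : ∀ η : ℝ, 0 < η → 0 < gammaConst K z (fun t => |t| ^ α) η) (R : ℝ) :
    ∃ κ : ℝ, 0 ≤ κ ∧ ∀ x : E, ‖x‖ ≤ R →
      infDist x (face K z) ≤ κ * max (infDist x (K : Set E)) (infDist x (perp z : Set E)) ^ α := by
  -- The boundary point `v` found below is within `3 * δ ≤ 3 * |R|` of `x`, so its norm is at most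
  -- `4 * |R|`; adding 1 makes the radius positive.
  obtain ⟨c, -, hc, hcγ⟩ := ENNReal.lt_iff_exists_real_btwn.1
    (hγ (4 * |R| + 1) (by positivity))
  have hc0 : 0 < c := ENNReal.ofReal_pos.1 hc
  refine ⟨5 * |R| ^ (1 - α) + 2 / c, by positivity, fun x hx => ?_⟩
  set δ := max (infDist x (K : Set E)) (infDist x (perp z : Set E))
  have hδ0 : 0 ≤ δ := infDist_nonneg.trans (le_max_left _ _)
  have hxR : ‖x‖ ≤ |R| := hx.trans (le_abs_self R)
  have hδR : δ ≤ |R| := by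
    refine (max_le ?_ ?_ : δ ≤ ‖x‖).trans hxR
    · simpa using infDist_le_dist_of_mem (x := x) K.zero_mem
    · simpa using infDist_le_dist_of_mem (x := x) (perp z).zero_mem
  have hδα : δ ≤ |R| ^ (1 - α) * δ ^ α := le_rpow_mul_rpow hδ0 hδR hα.2.le
  suffices h : infDist x (face K z) ≤ 5 * δ + 2 / c * δ ^ α by linarith
  have hrest : 0 ≤ 2 / c * δ ^ α := by positivity
  obtain ⟨y, hy, hxy⟩ := (isClosed_perp z).exists_infDist_eq_dist ⟨0, (perp z).zero_mem⟩ x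
  have hxy' : dist x y ≤ δ := hxy ▸ le_max_right _ _
  by_cases hyK : y ∈ (K : Set E)
  · linarith [infDist_le_dist_of_mem (x := x) (show y ∈ face K z from ⟨hyK, hy⟩)]
  -- Projecting `x` itself onto `K` could give an interior point. As `y ∉ K`, its nearest point in
  -- `K` is on the boundary, as `gammaConst` demands.
  obtain ⟨v, hv, hyv⟩ := exists_mem_frontier_infDist_compl_eq_dist (s := (K : Set E)ᶜ) hyK
    (fun h => by have : (0 : E) ∈ (K : Set E)ᶜ := h ▸ Set.mem_univ _
                 exact this K.zero_mem)
  rw [compl_compl] at hyv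
  rw [frontier_compl] at hv
  have hyv' : dist y v ≤ 2 * δ := by
    rw [← hyv]
    have h1 := infDist_le_infDist_add_dist (s := (K : Set E)) (x := y) (y := x)
    rw [dist_comm] at h1
    linarith [(le_max_left _ _ : infDist x (K : Set E) ≤ δ)]
  have hxv : dist x v ≤ 3 * δ := by linarith [dist_triangle x y v]
  by_cases hvF : v ∈ face K z
  · linarith [infDist_le_dist_of_mem (x := x) hvF]
  obtain ⟨w, hw, hvw⟩ := (isClosed_perp z).exists_infDist_eq_dist ⟨0, (perp z).zero_mem⟩ v
  obtain ⟨u, hu, hwu⟩ := (isClosed_face K z).exists_infDist_eq_dist ⟨0, zero_mem_face K z⟩ w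
  -- `y` is a competitor for the projection of `v` onto the hyperplane.
  have hvw' : dist v w ≤ 2 * δ := by
    rw [← hvw]
    exact (infDist_le_dist_of_mem hy).trans (dist_comm y v ▸ hyv')
  have hxu : infDist x (face K z) ≤ 5 * δ + dist w u := by
    linarith [infDist_le_dist_of_mem (x := x) hu, dist_triangle x v w, dist_triangle x w u]
  refine hxu.trans ?_
  gcongr
  rcases eq_or_ne w u with rfl | hne
  · simpa using hrest
  have hvn : ‖v‖ ≤ 4 * |R| + 1 := by
    have := norm_sub_norm_le v x
    rw [← dist_eq_norm, dist_comm] at this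
    linarith
  have hmem : gammaConst K z (fun t => |t| ^ α) (4 * |R| + 1) ≤
      ENNReal.ofReal (|‖w - v‖| ^ α / ‖w - u‖) :=
    sInf_le ⟨v, w, u, ⟨⟨hv, by simpa using hvn⟩, hvF⟩, ⟨hw, by rw [hvw, dist_eq_norm]⟩,
      ⟨hu, by rw [hwu, dist_eq_norm]⟩, hne, rfl⟩
  have hwu0 : 0 < dist w u := dist_pos.2 hne
  have hratio : c ≤ dist v w ^ α / dist w u := by
    have := hcγ.le.trans hmem
    rwa [ENNReal.ofReal_le_ofReal_iff (by positivity), abs_norm, ← dist_eq_norm, ← dist_eq_norm,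
      dist_comm w v] at this
  rw [le_div_iff₀ hwu0] at hratio
  rw [div_mul_eq_mul_div, le_div_iff₀ hc0, mul_comm]
  calc c * dist w u ≤ dist v w ^ α := hratio
    _ ≤ (2 * δ) ^ α := by gcongr; exact hα.1.le
    _ = 2 ^ α * δ ^ α := Real.mul_rpow two_pos.le hδ0
    _ ≤ 2 * δ ^ α := by
        gcongr
        simpa using Real.rpow_le_rpow_of_exponent_le one_le_two hα.2.le

end Face

/-! ### The curve witnessing optimality. -/

section Optimality

variable {E : Type*} [NormedAddCommGroup E] [InnerProductSpace ℝ E]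

/-- A curve in the hyperplane along which the distance to the cone is positive, tends to zero, and
whose power `α` is bounded by a multiple of the distance to the face. -/
lemma AsymptoticallyOptimal.exists_curve {K : ProperCone ℝ E} {z : E} {α : ℝ}
    (h : AsymptoticallyOptimal K z (fun t => |t| ^ α)) :
    ∃ (w : ℝ → E) (v : E) (ε₀ M : ℝ), 0 < ε₀ ∧ 0 < M ∧ ContinuousOn w (Set.Ioc 0 ε₀) ∧
      Tendsto w (𝓝[>] 0) (𝓝 v) ∧
      Tendsto (fun ε => infDist (w ε) (K : Set E)) (𝓝[>] 0) (𝓝 0) ∧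
      ∀ ε ∈ Set.Ioc 0 ε₀, w ε ∈ perp z ∧ 0 < infDist (w ε) (K : Set E) ∧
        infDist (w ε) (K : Set E) ^ α ≤ M * infDist (w ε) (face K z) := by
  obtain ⟨v, ⟨hv, -⟩, w, hwc, hw, hwv, hlim⟩ := h
  obtain ⟨M, hM1, hM2⟩ := EReal.lt_iff_exists_real_btwn.1 hlim
  have hev := eventually_lt_of_limsup_lt hM1
  obtain ⟨ε₁, hε₁, hsub⟩ := mem_nhdsGT_iff_exists_Ioc_subset.1 hev
  have hdK : ∀ ε ∈ Set.Ioc (0 : ℝ) 1, 0 < infDist (w ε) (K : Set E) := fun ε hε =>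
    (K.isClosed.notMem_iff_infDist_pos ⟨0, K.zero_mem⟩).1 fun hK =>
      (hw ε hε).2 ⟨hK, (hw ε hε).1.1⟩
  have hdF : ∀ ε ∈ Set.Ioc (0 : ℝ) 1, 0 < infDist (w ε) (face K z) := fun ε hε =>
    ((isClosed_face K z).notMem_iff_infDist_pos ⟨0, zero_mem_face K z⟩).1 (hw ε hε).2
  refine ⟨w, v, min ε₁ 1, max M 1, lt_min hε₁ one_pos, by positivity,
    hwc.mono (Set.Ioc_subset_Ioc_right (min_le_right _ _)), hwv, ?_, fun ε hε => ?_⟩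
  · have := ((continuous_infDist_pt (K : Set E)).tendsto v).comp hwv
    rwa [infDist_zero_of_mem hv.1] at this
  · have hε1 : ε ∈ Set.Ioc (0 : ℝ) 1 := ⟨hε.1, hε.2.trans (min_le_right _ _)⟩
    refine ⟨(hw ε hε1).1.1, hdK ε hε1, ?_⟩
    have h1 : |infDist (w ε) (K : Set E)| ^ α / infDist (w ε) (face K z) < M := by
      have := hsub ⟨hε.1, hε.2.trans (min_le_left _ _)⟩
      exact EReal.coe_lt_coe_iff.1 this
    rw [abs_of_pos (hdK ε hε1), div_lt_iff₀ (hdF ε hε1)] at h1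
    exact h1.le.trans (by gcongr; exacts [(hdF ε hε1).le, le_max_left _ _])

end Optimality

/-! ### The Hölderian bound and its sharpness. -/

/-- Under the PPS condition for the face, positivity of the constants `gammaConst` yields a uniform
Hölderian error bound for the cone and the affine subspace. -/
theorem uniformHolderErrorBound_of_gammaConst_pos
    {E : Type*} [NormedAddCommGroup E] [InnerProductSpace ℝ E] [FiniteDimensional ℝ E]
    {K : ProperCone ℝ E} {L : Submodule ℝ E} {a z : E} {α : ℝ}
    (hα : α ∈ Set.Ioo (0 : ℝ) 1)
    (hfeas : ((K : Set E) ∩ (AffineSubspace.mk' a L : Set E)).Nonempty)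
    (hzL : z ∈ Lᗮ) (hza : ⟪a, z⟫ = 0)
    (hPPS : PPS (face K z) (AffineSubspace.mk' a L : Set E))
    (hγ : ∀ η : ℝ, 0 < η → 0 < gammaConst K z (fun t => |t| ^ α) η) :
    UniformHolderErrorBound (K : Set E) (AffineSubspace.mk' a L : Set E) α := by
  set A : Set E := (AffineSubspace.mk' a L : Set E)
  have hAz : A ⊆ perp z := fun x hx => by
    have h1 : ⟪x - a, z⟫ = 0 := hzL _ (AffineSubspace.mem_mk'.1 hx)
    rw [inner_sub_left, hza, sub_zero, real_inner_comm] at h1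
    exact mem_perp.2 h1
  have hKA : (K : Set E) ∩ A = face K z ∩ A := by
    ext x
    exact ⟨fun h => ⟨⟨h.1, hAz h.2⟩, h.2⟩, fun h => ⟨h.1.1, h.2⟩⟩
  obtain ⟨q, hq⟩ := hfeas
  intro B hB
  obtain ⟨R, hR⟩ := hB.subset_closedBall 0
  obtain ⟨κ₁, hκ₁, h₁⟩ := hPPS.exists_infDist_inter_le (isClosed_face K z) (convex_face K z)
    (zero_mem_face K z) L a (hKA ▸ ⟨q, hq⟩) R
  obtain ⟨κ₂, hκ₂, h₂⟩ := exists_infDist_face_le K z hα hγ R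
  refine ⟨κ₁ * (κ₂ + |R + ‖q‖| ^ (1 - α)) + 1, by positivity, fun x hx => ?_⟩
  have hxR : ‖x‖ ≤ R := by simpa using hR hx
  have hxq : dist x q ≤ |R + ‖q‖| := by
    rw [dist_eq_norm]
    exact ((norm_sub_le x q).trans (by linarith)).trans (le_abs_self _)
  set δ := max (infDist x (K : Set E)) (infDist x A)
  have hδ0 : 0 ≤ δ := infDist_nonneg.trans (le_max_left _ _)
  have hδ : δ ≤ |R + ‖q‖| ^ (1 - α) * δ ^ α :=
    le_rpow_mul_rpow hδ0 (max_le ((infDist_le_dist_of_mem hq.1).trans hxq)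
      ((infDist_le_dist_of_mem hq.2).trans hxq)) hα.2.le
  have hF : infDist x (face K z) ≤ κ₂ * δ ^ α := by
    refine (h₂ x hxR).trans ?_
    gcongr
    · exact infDist_nonneg.trans (le_max_left _ _)
    · exact hα.1.le
    · exact max_le_max le_rfl (infDist_le_infDist_of_subset hAz ⟨q, hq.2⟩)
  have hδα : 0 ≤ δ ^ α := by positivity
  have hR0 : 0 ≤ |R + ‖q‖| ^ (1 - α) := by positivity
  rw [hKA]
  calc infDist x (face K z ∩ A) ≤ κ₁ * max (infDist x (face K z)) (infDist x A) := h₁ x hxR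
    _ ≤ κ₁ * ((κ₂ + |R + ‖q‖| ^ (1 - α)) * δ ^ α) := by
        gcongr
        refine max_le ?_ ?_
        · nlinarith [mul_nonneg hR0 hδα]
        · have := (le_max_right _ _ : infDist x A ≤ δ)
          nlinarith [mul_nonneg hκ₂ hδα]
    _ ≤ (κ₁ * (κ₂ + |R + ‖q‖| ^ (1 - α)) + 1) * δ ^ α := by linarith

/-- Every consistent error bound function dominates `s ^ α` up to rescaling. -/
theorem AsymptoticallyOptimal.exists_rpow_le
    {E : Type*} [NormedAddCommGroup E] [InnerProductSpace ℝ E]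
    {K : ProperCone ℝ E} {z : E} {α : ℝ} (hα : 0 < α)
    (hG1 : AsymptoticallyOptimal K z (fun t => |t| ^ α)) {Φ : ℝ≥0 → ℝ≥0 → ℝ≥0}
    (hΦ : IsConsistentErrorBound (K : Set E) (perp z : Set E) Φ) {η : ℝ≥0} (hη : 0 < η) :
    ∃ κ : ℝ≥0, 0 < κ ∧ ∃ s₀ : ℝ≥0, 0 < s₀ ∧
      ∀ s : ℝ≥0, s ≤ s₀ → s ^ α ≤ κ * Φ (κ * s) η := by
  obtain ⟨w, v, ε₀, M, hε₀, hM, hwc, hwv, hd0, hw⟩ := hG1.exists_curve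
  -- The curve's limit may have norm above `η`; scaling by `t` brings its tail into the ball of
  -- radius `η` and multiplies the distances to the cones by `t`.
  obtain ⟨t, ht, ht1, htη⟩ : ∃ t : ℝ, 0 < t ∧ t ≤ 1 ∧ t * ‖v‖ < η := by
    refine ⟨min 1 (η / (‖v‖ + 1)), lt_min one_pos (by positivity), min_le_left _ _, ?_⟩
    calc min 1 ((η : ℝ) / (‖v‖ + 1)) * ‖v‖ ≤ η / (‖v‖ + 1) * ‖v‖ := by
          gcongr; exact min_le_right _ _
      _ < η := by
          rw [div_mul_eq_mul_div, div_lt_iff₀ (by positivity)]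
          have : (0 : ℝ) < η := hη
          linarith
  have hev : ∀ᶠ ε in 𝓝[>] (0 : ℝ), t * ‖w ε‖ < η :=
    (hwv.norm.const_mul t).eventually_lt_const htη
  obtain ⟨ε₁, hε₁, hsub⟩ := mem_nhdsGT_iff_exists_Ioc_subset.1 hev
  set ε₂ := min ε₀ ε₁
  have hε₂ : 0 < ε₂ := lt_min hε₀ hε₁
  set d : ℝ → ℝ := fun ε => infDist (w ε) (K : Set E)
  have hdc : ContinuousOn d (Set.Ioc 0 ε₂) :=
    (continuous_infDist_pt _).comp_continuousOn
      (hwc.mono (Set.Ioc_subset_Ioc_right (min_le_left _ _)))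
  have hdpos : 0 < d ε₂ := (hw ε₂ ⟨hε₂, min_le_left _ _⟩).2.1
  -- Continuity of the curve enters here: every small `s > 0` must be attained as a distance to `K`,
  -- not merely a sequence of values.
  have hIVT : ∀ s : ℝ, 0 < s → s ≤ d ε₂ → ∃ ε ∈ Set.Ioc 0 ε₂, d ε = s := by
    intro s hs hs'
    obtain ⟨ε₃, h3, h3'⟩ := ((hd0.eventually_lt_const hs).and
      (Ioc_mem_nhdsGT hε₂)).exists
    obtain ⟨ε, hε, rfl⟩ := intermediate_value_Icc h3'.2
      (hdc.mono fun ε hε => ⟨h3'.1.trans_le hε.1, hε.2⟩) ⟨h3.le, hs'⟩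
    exact ⟨ε, ⟨h3'.1.trans_le hε.1, hε.2⟩, rfl⟩
  -- The 1 gives `t * s ≤ κ * s` inside `Φ`; the `M / t` undoes the scaling and pays for `M`
  -- outside.
  refine ⟨⟨max 1 (M / t), by positivity⟩, lt_of_lt_of_le one_pos
    (NNReal.coe_le_coe.1 (le_max_left _ _)), ⟨d ε₂, hdpos.le⟩, hdpos, fun s hs => ?_⟩
  rcases eq_or_ne s 0 with rfl | hs0
  · rw [NNReal.zero_rpow hα.ne']
    exact zero_le
  obtain ⟨ε, hε, hdε⟩ := hIVT s (NNReal.coe_pos.2 (pos_iff_ne_zero.2 hs0)) hs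
  have hε0 : ε ∈ Set.Ioc 0 ε₀ := ⟨hε.1, hε.2.trans (min_le_left _ _)⟩
  obtain ⟨hwz, -, hwα⟩ := hw ε hε0
  have hwη : t * ‖w ε‖ ≤ η := le_of_lt (hsub ⟨hε.1, hε.2.trans (min_le_right _ _)⟩)
  set κ : ℝ≥0 := ⟨max 1 (M / t), by positivity⟩
  have hΦw := hΦ.infDist_le (t • w ε)
  have hzero : infNndist (t • w ε) (perp z : Set E) = 0 := by
    rw [← NNReal.coe_eq_zero, coe_infNndist]
    exact infDist_zero_of_mem ((perp z).smul_mem t hwz)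
  have hK : infNndist (t • w ε) (K : Set E) ≤ κ * s := by
    rw [← NNReal.coe_le_coe, coe_infNndist, infDist_smul_of_smul_eq ht (smul_properCone K ht),
      NNReal.coe_mul]
    change t * d ε ≤ max 1 (M / t) * s
    rw [hdε]
    gcongr
    exact ht1.trans (le_max_left _ _)
  have hle : t * infDist (w ε) (face K z) ≤ Φ (κ * s) η := by
    rw [← infDist_smul_of_smul_eq ht (smul_face K z ht)]
    refine hΦw.trans (NNReal.coe_le_coe.2 ?_)
    rw [hzero, max_eq_left (zero_le)]
    refine (hΦ.mono_left _ hK).trans (hΦ.mono_right _ ?_)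
    rw [← NNReal.coe_le_coe, coe_nnnorm, norm_smul, Real.norm_of_nonneg ht.le]
    exact hwη
  rw [← NNReal.coe_le_coe, NNReal.coe_rpow, NNReal.coe_mul, ← hdε]
  calc d ε ^ α ≤ M * infDist (w ε) (face K z) := hwα
    _ = M / t * (t * infDist (w ε) (face K z)) := by field_simp
    _ ≤ max 1 (M / t) * Φ (κ * s) η := by
        gcongr
        · exact mul_nonneg ht.le infDist_nonneg
        · exact le_max_right _ _

/-- No Hölderian error bound holds with an exponent larger than the asymptotically optimal one. -/
theorem AsymptoticallyOptimal.not_uniformHolderErrorBound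
    {E : Type*} [NormedAddCommGroup E] [InnerProductSpace ℝ E]
    {K : ProperCone ℝ E} {z : E} {α β : ℝ}
    (hG1 : AsymptoticallyOptimal K z (fun t => |t| ^ α)) (hβ : α < β) :
    ¬ UniformHolderErrorBound (K : Set E) (perp z : Set E) β := by
  intro h
  obtain ⟨w, v, ε₀, M, hε₀, hM, hwc, hwv, hd0, hw⟩ := hG1.exists_curve
  obtain ⟨κ, hκ, hle⟩ := h (ball v 1) isBounded_ball
  -- On the curve a bound with exponent `β` would give `1 ≤ M * κ * d ^ (β - α)`, where `d` is the
  -- distance to `K`; the right side tends to 0.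
  have hlim : Tendsto (fun ε => M * κ * infDist (w ε) (K : Set E) ^ (β - α)) (𝓝[>] 0) (𝓝 0) := by
    have := (hd0.rpow_const (p := β - α) (Or.inr (by linarith))).const_mul (M * κ)
    rwa [Real.zero_rpow (by linarith), mul_zero] at this
  obtain ⟨ε, ⟨h1, h2⟩, h3⟩ := (((hlim.eventually_lt_const one_pos).and
    (hwv.eventually (ball_mem_nhds v one_pos))).and (Ioc_mem_nhdsGT hε₀)).exists
  obtain ⟨hz, hpos, hα'⟩ := hw ε h3
  have h4 := hle (w ε) h2
  rw [infDist_zero_of_mem (show w ε ∈ (perp z : Set E) from hz), max_eq_left hpos.le] at h4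
  have h5 : infDist (w ε) (K : Set E) ^ β =
      infDist (w ε) (K : Set E) ^ (β - α) * infDist (w ε) (K : Set E) ^ α := by
    rw [← Real.rpow_add hpos, sub_add_cancel]
  have h6 : infDist (w ε) (K : Set E) ^ α ≤
      M * κ * infDist (w ε) (K : Set E) ^ (β - α) * infDist (w ε) (K : Set E) ^ α := by
    calc _ ≤ M * infDist (w ε) (face K z) := hα'
      _ ≤ M * (κ * infDist (w ε) (K : Set E) ^ β) := by gcongr; exact h4
      _ = _ := by rw [h5]; ring
  have h7 : 0 < infDist (w ε) (K : Set E) ^ α := by positivity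
  nlinarith

end ConicErrorBound

theorem corollary3p7
    {E : Type*} [NormedAddCommGroup E] [InnerProductSpace ℝ E] [FiniteDimensional ℝ E]
    (K : ProperCone ℝ E) (L : Submodule ℝ E) (a z : E) (α : ℝ)
    (hα : α ∈ Set.Ioo (0 : ℝ) 1)
    (hfeas : ((K : Set E) ∩ (AffineSubspace.mk' a L : Set E)).Nonempty)
    (hzK : z ∈ ProperCone.innerDual (K : Set E)) (hzL : z ∈ Lᗮ) (hza : inner ℝ a z = 0)
    (hF : ConicErrorBound.IsNontrivialFace K (ConicErrorBound.face K z))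
    (hPPS : ConicErrorBound.PPS (ConicErrorBound.face K z) (AffineSubspace.mk' a L : Set E))
    (hγ : ∀ η : ℝ, 0 < η → 0 < ConicErrorBound.gammaConst K z (fun t => |t| ^ α) η)
    (hSH : ConicErrorBound.PartiallySubhomogeneous (fun t => |t| ^ α))
    (hG1 : ConicErrorBound.AsymptoticallyOptimal K z (fun t => |t| ^ α)) :
    ConicErrorBound.UniformHolderErrorBound (K : Set E) (AffineSubspace.mk' a L : Set E) α ∧
    (‖z‖ = 1 → L = ConicErrorBound.perp z → a = 0 →
      (∀ Φ : ℝ≥0 → ℝ≥0 → ℝ≥0,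
        ConicErrorBound.IsConsistentErrorBound (K : Set E) (L : Set E) Φ →
        ∀ η : ℝ≥0, 0 < η → ∃ κ : ℝ≥0, 0 < κ ∧ ∃ s₀ : ℝ≥0, 0 < s₀ ∧
          ∀ s : ℝ≥0, s ≤ s₀ → s ^ α ≤ κ * Φ (κ * s) η) ∧
      (∀ β : ℝ, α < β → β ≤ 1 →
        ¬ ConicErrorBound.UniformHolderErrorBound (K : Set E) (L : Set E) β)) := by 
  refine ⟨ConicErrorBound.uniformHolderErrorBound_of_gammaConst_pos hα hfeas hzL hza hPPS hγ, ?_⟩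
  rintro - rfl -
  exact ⟨fun Φ hΦ η hη => hG1.exists_rpow_le hα.1 hΦ hη,
    fun β hβ _ => hG1.not_uniformHolderErrorBound hβ⟩
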